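/- Let $S$ be a finite semigroup. Let $S^1 = S$ if $S$ has an identity element, and otherwise let $S^1 = S \cup \{1\}$ be $S$ with an identity element $1$ adjoined. For a set $X$ let $X^*$ denote the set of all finite words over $X$, including the empty word $\epsilon$. For each $s \in S$ define $$\varphi_s : (S^1)^* \to S^* \subseteq (S^1)^*, \qquad \varphi_s([a_1, a_2, \ldots, a_n]) = [s a_1,\ s a_1 a_2,\ \ldots,\ s a_1 a_2 \cdots a_n], \qquad \varphi_s(\epsilon) = \epsilon,$$ and let $\mathrm{Cayley}(S)$ be the semigroup of maps $(S^1)^* \to (S^1)^*$ generated under composition by $\{\varphi_s : s \in S\}$. The semigroup $S$ is called aperiodic if every subsemigroup of $S$ that is a group under the multiplication of $S$ is trivial. If $S$ is a finite aperiodic semigroup, then $\mathrm{Cayley}(S)$ is finite. -/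

import Mathlib

/-- `e` is a (two-sided) identity element of the semigroup `S`. -/
def IsIdentityElement {S : Type*} [Semigroup S] (e : S) : Prop :=
  ∀ s : S, e * s = s ∧ s * e = s

/-- The subsemigroup `G` of `S` is a subgroup of `S`: it is a group under the multiplication of `S`
(its identity `e` is an idempotent of `S`, not necessarily an identity of `S`). -/
def IsSubgroupOfSemigroup {S : Type*} [Semigroup S] (G : Subsemigroup S) : Prop :=
  ∃ e ∈ G, (∀ x ∈ G, e * x = x ∧ x * e = x) ∧ ∀ x ∈ G, ∃ y ∈ G, x * y = e ∧ y * x = e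

/-- A semigroup is aperiodic if it has no nontrivial subgroups. -/
def IsAperiodic (S : Type*) [Semigroup S] : Prop :=
  ∀ G : Subsemigroup S, IsSubgroupOfSemigroup G → (G : Set S).Subsingleton

/-- The semigroup `S¹`. Inside `S ∪ {1}` (Mathlib's `WithOne S`), it is the copy of `S` if `S`
already has an identity element, and all of `S ∪ {1}` otherwise. -/
def adjoinIdentity (S : Type*) [Semigroup S] : Subsemigroup (WithOne S) where
  carrier := {a | a = 1 → ¬ ∃ e : S, IsIdentityElement e}
  mul_mem' := by
    intro a b ha hb hab
    cases a with
    | one => exact ha rfl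
    | coe a =>
      cases b with
      | one => exact hb rfl
      | coe b =>
        rw [← WithOne.coe_mul] at hab
        exact absurd hab WithOne.coe_ne_one

/-- The inclusion of `S` in `S¹`. -/
def toAdjoinIdentity {S : Type*} [Semigroup S] (s : S) : adjoinIdentity S :=
  ⟨(s : WithOne S), fun h => absurd h WithOne.coe_ne_one⟩

/-- For `q` in a semigroup `Q`, the map on words over `Q` given by
`[a₁, a₂, …, aₙ] ↦ [q a₁, q a₁ a₂, …, q a₁ a₂ ⋯ aₙ]`, with the empty word sent to itself. -/
def partialProducts {Q : Type*} [Semigroup Q] : Q → List Q → List Q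
  | _, [] => []
  | q, a :: w => (q * a) :: partialProducts (q * a) w

/-- For `s : S`, the map `φ_s` on the words over `S¹`; see `cayleyMap_mem` for the fact that all
letters of its values lie in `S`. -/
def cayleyMap {S : Type*} [Semigroup S] (s : S) : Function.End (List (adjoinIdentity S)) :=
  partialProducts (toAdjoinIdentity s)

/-- The semigroup `Cayley(S)` generated, under composition, by the maps `φ_s`, `s ∈ S`. -/
def Cayley (S : Type*) [Semigroup S] : Subsemigroup (Function.End (List (adjoinIdentity S))) :=
  Subsemigroup.closure (Set.range (cayleyMap (S := S)))

/-- The values of `φ_s` are words over `S`. -/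
theorem cayleyMap_mem {S : Type*} [Semigroup S] (s : S) (w : List (adjoinIdentity S)) :
    ∀ x ∈ cayleyMap s w, ∃ t : S, x = toAdjoinIdentity t := by
  induction w generalizing s with
  | nil => intro x hx; exact absurd hx List.not_mem_nil
  | cons a w ih =>
    obtain ⟨t, ht⟩ : ∃ t : S, toAdjoinIdentity s * a = toAdjoinIdentity t := by
      obtain ⟨a, ha⟩ := a
      cases a with
      | one => exact ⟨s, Subtype.ext (mul_one _)⟩
      | coe a => exact ⟨s * a, rfl⟩
    intro x hx
    have h : x ∈ (toAdjoinIdentity s * a) :: partialProducts (toAdjoinIdentity s * a) w := hx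
    rw [ht] at h
    rcases List.mem_cons.1 h with h | h
    · exact ⟨t, h⟩
    · exact ih t x h

/-!
For a word `σ = [s₁, …, s_k]` over a finite monoid `M`, let `wordMap σ = φ_{s_k} ∘ ⋯ ∘ φ_{s₁}`. Read
as a Mealy machine, `wordMap σ` sends the letter `b` to `s_k ⋯ s₁ b` and passes to the state
`stateAfter σ b = [s₁ b, s₂ s₁ b, …, s_k ⋯ s₁ b]`. In an aperiodic `M` there are only finitely many
maps `wordMap σ`; the theorem follows by taking `M = S ∪ {1}`.

The proof is by induction on a two-sided ideal `I` containing the letters of `σ`. Let `J` be a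
maximal proper subideal of `I`; then `I \ J` lies in one 𝒥-class. The word `stateAfter σ b` is
descending in the 𝓛-order, so by stability it is a word over a single 𝓛-class in `I \ J` followed by
a word over `J`. By the induction hypothesis it remains to treat words `B` over one 𝓛-class.

For such `B = [x₁, …, x_m]`, triviality of 𝓗 gives `x_i ⋯ x₁ b = x_i b` as long as this product is
outside `J` (`stateAfter_eq_map`). So the state after `b` is `[x₁ b, …, x_r b]` followed by a word
over `J`. If `0 < r < m`, the letter `x_r` does not occur among `x₁, …, x_{r-1}`
(`exists_stateAfter_eq_map_append`): a product that stays outside `J` after the first occurrence of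
a letter stays outside `J` after every later one. Consequently all states reachable from `B` are,
up to a word over `J`, of the form `[x₁ c, …, x_r c]` with `c ∈ M` and `r` equal to `0`, to `m` or
to the position of the first occurrence of some letter. Their number is bounded independently of
`B`, and there are only finitely many machines of bounded size (`finite_of_uniform_recursion`).
-/

/-! ### Stability and triviality of 𝓗 in aperiodic monoids -/

section Aperiodic

variable {M : Type*} [Monoid M]

theorem eq_pow_mul_mul_pow {x u v : M} (h : x = u * x * v) (n : ℕ) : x = u ^ n * x * v ^ n := by
  induction n with
  | zero => simp
  | succ n ih =>
    calc x = u ^ n * x * v ^ n := ih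
      _ = u ^ n * (u * x * v) * v ^ n := by rw [← h]
      _ = u ^ (n + 1) * x * v ^ (n + 1) := by rw [pow_succ, pow_succ']; simp only [mul_assoc]

theorem eq_mul_right_of_eq_mul_mul (hM : ∀ x : M, ∃ n : ℕ, x ^ (n + 1) = x ^ n) {x u v : M}
    (h : x = u * x * v) : x = x * v := by
  obtain ⟨n, hn⟩ := hM v
  have h' := eq_pow_mul_mul_pow h n
  calc x = u ^ n * x * v ^ n := h'
    _ = u ^ n * x * v ^ n * v := by rw [mul_assoc _ (v ^ n) v, ← pow_succ, hn]
    _ = x * v := by rw [← h']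

theorem eq_mul_left_of_eq_mul_mul (hM : ∀ x : M, ∃ n : ℕ, x ^ (n + 1) = x ^ n) {x u v : M}
    (h : x = u * x * v) : x = u * x := by
  obtain ⟨n, hn⟩ := hM u
  have h' := eq_pow_mul_mul_pow h n
  calc x = u ^ n * x * v ^ n := h'
    _ = u * (u ^ n * x * v ^ n) := by
      rw [← mul_assoc, ← mul_assoc, ← pow_succ', hn]
    _ = u * x := by rw [← h']

/-- Two elements that are both 𝓛- and 𝓡-related are equal; one half of each relation suffices. -/
theorem eq_of_greenL_of_greenR (hM : ∀ x : M, ∃ n : ℕ, x ^ (n + 1) = x ^ n) {x y a d : M}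
    (hL : x = a * y) (hR : y = x * d) : x = y := by
  rw [hR]
  apply eq_mul_right_of_eq_mul_mul hM (u := a)
  rw [mul_assoc, ← hR, hL]

/-- `J ⊆ I` are two-sided ideals of `M` (possibly empty) and all elements of `I \ J` generate the
same two-sided ideal, that is, they lie in one 𝒥-class. -/
structure IsPrincipalFactor (J I : Set M) : Prop where
  subset : J ⊆ I
  lower : ∀ x ∈ J, ∀ a b : M, a * x * b ∈ J
  upper : ∀ x ∈ I, ∀ a b : M, a * x * b ∈ I
  factor : ∀ x ∈ I \ J, ∀ y ∈ I \ J, ∃ u v, y = u * x * v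

namespace IsPrincipalFactor

variable {I J : Set M}

theorem mul_left_lower (h : IsPrincipalFactor J I) {x : M} (hx : x ∈ J) (a : M) : a * x ∈ J := by
  simpa using h.lower x hx a 1

theorem mul_right_lower (h : IsPrincipalFactor J I) {x : M} (hx : x ∈ J) (a : M) : x * a ∈ J := by
  simpa using h.lower x hx 1 a

theorem mul_left_upper (h : IsPrincipalFactor J I) {x : M} (hx : x ∈ I) (a : M) : a * x ∈ I := by
  simpa using h.upper x hx a 1

theorem mul_right_upper (h : IsPrincipalFactor J I) {x : M} (hx : x ∈ I) (a : M) : x * a ∈ I := by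
  simpa using h.upper x hx 1 a

theorem exists_eq_mul_left (hM : ∀ x : M, ∃ n : ℕ, x ^ (n + 1) = x ^ n)
    (h : IsPrincipalFactor J I) {x y : M} (hy : y ∈ I) (hxy : x * y ∉ J) :
    ∃ u, y = u * (x * y) := by
  obtain ⟨u, v, huv⟩ := h.factor (x * y) ⟨h.mul_left_upper hy x, hxy⟩ y
    ⟨hy, fun hJ => hxy (h.mul_left_lower hJ x)⟩
  refine ⟨u, ?_⟩
  rw [← mul_assoc]
  exact eq_mul_left_of_eq_mul_mul hM (v := v) (by rw [mul_assoc u x y]; exact huv)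

theorem exists_eq_mul_right (hM : ∀ x : M, ∃ n : ℕ, x ^ (n + 1) = x ^ n)
    (h : IsPrincipalFactor J I) {x y : M} (hx : x ∈ I) (hxy : x * y ∉ J) :
    ∃ v, x = x * y * v := by
  obtain ⟨u, v, huv⟩ := h.factor (x * y) ⟨h.mul_right_upper hx y, hxy⟩ x
    ⟨hx, fun hJ => hxy (h.mul_right_lower hJ y)⟩
  refine ⟨v, ?_⟩
  rw [mul_assoc]
  exact eq_mul_right_of_eq_mul_mul hM (u := u) (by simpa only [mul_assoc] using huv)

/-- If `x` and `y` are 𝓛-related and `x * y` is in the same 𝒥-class, then `x * y` is 𝓡-related to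
`x` and 𝓛-related to `y`, hence equal to `x`. -/
theorem mul_eq_left (hM : ∀ x : M, ∃ n : ℕ, x ^ (n + 1) = x ^ n)
    (h : IsPrincipalFactor J I) {x y a : M} (hx : x ∈ I) (hy : y ∈ I) (hL : x = a * y)
    (hxy : x * y ∉ J) : x * y = x := by
  obtain ⟨u, hu⟩ := h.exists_eq_mul_left hM hy hxy
  obtain ⟨v, hv⟩ := h.exists_eq_mul_right hM hx hxy
  refine (eq_of_greenL_of_greenR hM (a := a * u) (d := y) ?_ rfl).symm
  rw [mul_assoc, ← hu, hL]

end IsPrincipalFactor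

/-- A nonempty two-sided ideal of a finite monoid has a maximal proper subideal. -/
theorem exists_isPrincipalFactor [Finite M] {I : Set M} (hI : ∀ x ∈ I, ∀ a b : M, a * x * b ∈ I)
    (hne : I.Nonempty) : ∃ J, J ⊂ I ∧ IsPrincipalFactor J I := by
  obtain ⟨J, hJ⟩ := (Set.toFinite
    {J : Set M | J ⊂ I ∧ ∀ x ∈ J, ∀ a b : M, a * x * b ∈ J}).exists_maximal
    ⟨∅, by rwa [Set.empty_ssubset], by simp⟩
  refine ⟨J, hJ.prop.1, hJ.prop.1.subset, hJ.prop.2, hI, ?_⟩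
  rintro x ⟨hxI, hxJ⟩ y ⟨hyI, hyJ⟩
  by_contra hxy
  -- otherwise `J` together with the principal ideal of `x` is a larger proper subideal
  let K : Set M := J ∪ {z | ∃ u v, z = u * x * v}
  have hKI : K ⊆ I := by
    rintro z (hz | ⟨u, v, rfl⟩)
    · exact hJ.prop.1.subset hz
    · exact hI x hxI u v
  have hyK : y ∉ K := by
    rintro (hy | hy)
    · exact hyJ hy
    · exact hxy hy
  have hK : ∀ z ∈ K, ∀ a b : M, a * z * b ∈ K := by
    rintro z (hz | ⟨u, v, rfl⟩) a b
    · exact Or.inl (hJ.prop.2 z hz a b)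
    · exact Or.inr ⟨a * u, v * b, by simp only [mul_assoc]⟩
  exact hxJ (hJ.le_of_ge (y := K) ⟨⟨hKI, fun h => hyK (h hyI)⟩, hK⟩ Set.subset_union_left
    (Or.inr ⟨1, 1, by simp⟩))

end Aperiodic

/-! ### Machines of bounded size -/

/-- Finitely many data `(o, t)` determine a family `h : ι → List A → List A` by
`h i [] = []`, `h i (b :: w) = o i b :: g (h j w)` with `t i b = (g, j)`, if the maps `g` are taken
from a finite set `G`. Hence only finitely many maps belong to such families. -/
theorem finite_of_uniform_recursion {A ι : Type*} [Finite A] [Finite ι]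
    {G : Set (List A → List A)} (hG : G.Finite) {F : Set (List A → List A)}
    (hF : ∀ f ∈ F, ∃ h : ι → List A → List A, (∃ i, h i = f) ∧ (∀ i, h i [] = []) ∧
      ∃ o : ι → A → A, ∀ i b, ∃ g ∈ G, ∃ j, ∀ w, h i (b :: w) = o i b :: g (h j w)) :
    F.Finite := by
  have := hG.to_subtype
  let run (m : (ι → A → A) × (ι → A → G × ι)) : List A → ι → List A := fun w =>
    w.rec (fun _ => []) fun b _ r i => m.1 i b :: (m.2 i b).1.1 (r (m.2 i b).2)
  refine (Set.finite_range fun m : ((ι → A → A) × (ι → A → G × ι)) × ι =>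
    fun w => run m.1 w m.2).subset fun f hf => ?_
  obtain ⟨h, ⟨i, rfl⟩, hnil, o, ho⟩ := hF f hf
  choose g hg j hj using ho
  refine ⟨((o, fun i b => (⟨g i b, hg i b⟩, j i b)), i), ?_⟩
  clear hf
  funext w
  induction w generalizing i with
  | nil => exact (hnil i).symm
  | cons b w ih =>
    rw [hj, ← ih (j i b)]

/-! ### Compositions of partial product maps -/

section WordMap

variable {M : Type*} [Monoid M]

/-- The composition of the maps `partialProducts s` over the letters `s` of the word, the first
letter acting first. -/
def wordMap : List M → List M → List M
  | [] => id
  | s :: σ => wordMap σ ∘ partialProducts s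

/-- The product `s_k ⋯ s₁ b` for the word `[s₁, …, s_k]`: the first letter of the output of
`wordMap` on a word beginning with `b`. -/
def leftAction : List M → M → M
  | [], b => b
  | s :: σ, b => leftAction σ (s * b)

/-- The word `[s₁ b, s₂ s₁ b, …, s_k ⋯ s₁ b]`, for the word `[s₁, …, s_k]`: the state that the
machine `wordMap` reaches on reading `b`. -/
def stateAfter : List M → M → List M
  | [], _ => []
  | s :: σ, b => (s * b) :: stateAfter σ (s * b)

theorem wordMap_nil_right (σ : List M) : wordMap σ [] = [] := by
  induction σ with
  | nil => rfl
  | cons s σ ih => exact ih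

theorem wordMap_cons_right (σ : List M) (b : M) (w : List M) :
    wordMap σ (b :: w) = leftAction σ b :: wordMap (stateAfter σ b) w := by
  induction σ generalizing b w with
  | nil => rfl
  | cons s σ ih => exact ih (s * b) (partialProducts (s * b) w)

theorem wordMap_append (σ τ : List M) : wordMap (σ ++ τ) = wordMap τ ∘ wordMap σ := by
  induction σ with
  | nil => rfl
  | cons s σ ih => rw [List.cons_append, wordMap, ih]; rfl

theorem stateAfter_append (σ τ : List M) (b : M) :
    stateAfter (σ ++ τ) b = stateAfter σ b ++ stateAfter τ (leftAction σ b) := by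
  induction σ generalizing b with
  | nil => rfl
  | cons s σ ih => simp only [List.cons_append, stateAfter, leftAction, ih]

theorem leftAction_append (σ τ : List M) (b : M) :
    leftAction (σ ++ τ) b = leftAction τ (leftAction σ b) := by
  induction σ generalizing b with
  | nil => rfl
  | cons s σ ih => simp only [List.cons_append, leftAction, ih]

/-- All letters of the word are 𝓛-related. -/
def IsGreenLWord (C : List M) : Prop :=
  ∀ x ∈ C, ∀ y ∈ C, ∃ u, x = u * y

theorem IsGreenLWord.of_subset {C C' : List M} (hC : IsGreenLWord C) (h : C' ⊆ C) :
    IsGreenLWord C' :=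
  fun x hx y hy => hC x (h hx) y (h hy)

theorem IsGreenLWord.map_mul_right {C : List M} (hC : IsGreenLWord C) (c : M) :
    IsGreenLWord (C.map (· * c)) := by
  simp only [IsGreenLWord, List.mem_map]
  rintro _ ⟨x, hx, rfl⟩ _ ⟨y, hy, rfl⟩
  obtain ⟨u, rfl⟩ := hC x hx y hy
  exact ⟨u, mul_assoc _ _ _⟩

/-! ### The states of a machine over a principal factor -/

section PrincipalFactor

variable {I J : Set M}

theorem stateAfter_mem_lower (h : IsPrincipalFactor J I) {b : M} (hb : b ∈ J) (C : List M) :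
    ∀ t ∈ stateAfter C b, t ∈ J := by
  induction C generalizing b with
  | nil => simp [stateAfter]
  | cons s C ih =>
    have := h.mul_left_lower hb s
    simpa [stateAfter, this] using ih this

/-- Since the letters of a state descend in the 𝓛-order, those outside `J` come first. -/
theorem exists_stateAfter_split (h : IsPrincipalFactor J I) (C : List M) (hC : ∀ x ∈ C, x ∈ I)
    (b : M) : ∃ C₁ C₂, C = C₁ ++ C₂ ∧ (∀ t ∈ stateAfter C₁ b, t ∈ I \ J) ∧
      ∀ t ∈ stateAfter C₂ (leftAction C₁ b), t ∈ J := by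
  induction C generalizing b with
  | nil => exact ⟨[], [], rfl, by simp [stateAfter], by simp [stateAfter]⟩
  | cons s C ih =>
    have hs : s * b ∈ I := h.mul_right_upper (hC s List.mem_cons_self) b
    by_cases hsb : s * b ∈ J
    · refine ⟨[], s :: C, rfl, by simp [stateAfter], ?_⟩
      simpa [stateAfter, leftAction, hsb] using stateAfter_mem_lower h hsb C
    · obtain ⟨C₁, C₂, rfl, h₁, h₂⟩ := ih (fun x hx => hC x (List.mem_cons_of_mem _ hx)) (s * b)
      refine ⟨s :: C₁, C₂, rfl, ?_, h₂⟩
      simpa [stateAfter, hs, hsb] using h₁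

theorem exists_greenL_of_mem_stateAfter (hM : ∀ x : M, ∃ n : ℕ, x ^ (n + 1) = x ^ n)
    (h : IsPrincipalFactor J I) (C : List M) {b : M} (hb : b ∈ I)
    (hC : ∀ t ∈ stateAfter C b, t ∈ I \ J) :
    ∀ t ∈ stateAfter C b, (∃ u, t = u * b) ∧ ∃ u, b = u * t := by
  induction C generalizing b with
  | nil => simp [stateAfter]
  | cons s C ih =>
    simp only [stateAfter, List.mem_cons, forall_eq_or_imp] at hC ⊢
    obtain ⟨u, hu⟩ := h.exists_eq_mul_left hM hb hC.1.2
    refine ⟨⟨⟨s, rfl⟩, u, hu⟩, fun t ht => ?_⟩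
    obtain ⟨⟨v, hv⟩, w, hw⟩ := ih hC.1.1 hC.2 t ht
    exact ⟨⟨v * s, by rw [hv, mul_assoc]⟩, u * w, by rw [mul_assoc, ← hw, ← hu]⟩

theorem isGreenLWord_stateAfter (hM : ∀ x : M, ∃ n : ℕ, x ^ (n + 1) = x ^ n)
    (h : IsPrincipalFactor J I) (C : List M) {b : M} (hC : ∀ t ∈ stateAfter C b, t ∈ I \ J) :
    IsGreenLWord (stateAfter C b) := by
  cases C with
  | nil => simp [stateAfter, IsGreenLWord]
  | cons s C =>
    simp only [stateAfter, List.mem_cons, forall_eq_or_imp] at hC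
    have key : ∀ t ∈ stateAfter (s :: C) b, (∃ u, t = u * (s * b)) ∧ ∃ u, s * b = u * t := by
      simp only [stateAfter, List.mem_cons, forall_eq_or_imp]
      exact ⟨⟨⟨1, by simp⟩, 1, by simp⟩, exists_greenL_of_mem_stateAfter hM h C hC.1.1 hC.2⟩
    intro x hx y hy
    obtain ⟨u, hu⟩ := (key x hx).1
    obtain ⟨v, hv⟩ := (key y hy).2
    exact ⟨u * v, by rw [hu, hv, mul_assoc]⟩

theorem stateAfter_mul_eq_map (hM : ∀ x : M, ∃ n : ℕ, x ^ (n + 1) = x ^ n)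
    (h : IsPrincipalFactor J I) {C : List M} {y : M} (hCI : ∀ x ∈ y :: C, x ∈ I)
    (hL : IsGreenLWord (y :: C)) {b : M} (hC : ∀ t ∈ stateAfter C (y * b), t ∈ I \ J) :
    stateAfter C (y * b) = C.map (· * b) := by
  induction C generalizing y with
  | nil => rfl
  | cons s C ih =>
    simp only [stateAfter, List.mem_cons, forall_eq_or_imp] at hC
    have hs : s * y = s := by
      obtain ⟨u, hu⟩ := hL s (by simp) y (by simp)
      refine h.mul_eq_left hM (hCI s (by simp)) (hCI y (by simp)) hu fun hJ => hC.1.2 ?_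
      rw [← mul_assoc]
      exact h.mul_right_lower hJ b
    rw [← mul_assoc, hs] at hC
    rw [stateAfter, ← mul_assoc, hs, List.map_cons,
      ih (fun x hx => hCI x (List.mem_cons_of_mem _ hx))
        (hL.of_subset (List.subset_cons_self _ _)) hC.2]

theorem stateAfter_eq_map (hM : ∀ x : M, ∃ n : ℕ, x ^ (n + 1) = x ^ n)
    (h : IsPrincipalFactor J I) {C : List M} (hCI : ∀ x ∈ C, x ∈ I) (hL : IsGreenLWord C) {b : M}
    (hC : ∀ t ∈ stateAfter C b, t ∈ I \ J) : stateAfter C b = C.map (· * b) := by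
  cases C with
  | nil => rfl
  | cons y C =>
    simp only [stateAfter, List.mem_cons, forall_eq_or_imp] at hC
    rw [stateAfter, stateAfter_mul_eq_map hM h hCI hL hC.2, List.map_cons]

theorem leftAction_concat (hM : ∀ x : M, ∃ n : ℕ, x ^ (n + 1) = x ^ n)
    (h : IsPrincipalFactor J I) {P : List M} {x : M} (hPI : ∀ y ∈ P ++ [x], y ∈ I)
    (hL : IsGreenLWord (P ++ [x])) {b : M} (hP : ∀ t ∈ stateAfter (P ++ [x]) b, t ∈ I \ J) :
    leftAction (P ++ [x]) b = x * b := by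
  have hmap := stateAfter_eq_map hM h hPI hL hP
  have hlast : ∀ a : M, stateAfter [x] a = [leftAction [x] a] := fun _ => rfl
  rw [stateAfter_append, hlast, ← leftAction_append, List.map_append] at hmap
  simpa using (List.append_inj' hmap rfl).2

/-- If the part of the state outside `J` comes from a nonempty proper prefix `[x₁, …, x_r]`, then
`x_r` does not occur earlier: an earlier occurrence is followed within the prefix by some `z` with
`z x_r b ∉ J`, and then `y x_r b ∉ J` for the letter `y` following the prefix, because `y` is
𝓛-related to `z`. -/
theorem exists_stateAfter_eq_map_append (hM : ∀ x : M, ∃ n : ℕ, x ^ (n + 1) = x ^ n)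
    (h : IsPrincipalFactor J I) {C : List M} (hCI : ∀ x ∈ C, x ∈ I) (hL : IsGreenLWord C) (b : M) :
    ∃ C₁ C₂ τ, C = C₁ ++ C₂ ∧ stateAfter C b = C₁.map (· * b) ++ τ ∧ (∀ t ∈ τ, t ∈ J) ∧
      (C₁ = [] ∨ C₂ = [] ∨ ∃ P x, C₁ = P ++ [x] ∧ x ∉ P) := by
  obtain ⟨C₁, C₂, rfl, h₁, h₂⟩ := exists_stateAfter_split h C hCI b
  have hmap : stateAfter C₁ b = C₁.map (· * b) :=
    stateAfter_eq_map hM h (fun x hx => hCI x (List.mem_append_left _ hx))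
      (hL.of_subset (List.subset_append_left _ _)) h₁
  refine ⟨C₁, C₂, _, rfl, by rw [stateAfter_append, hmap], h₂, ?_⟩
  rcases C₂ with _ | ⟨y, C₂⟩
  · simp
  rcases List.eq_nil_or_concat' C₁ with rfl | ⟨P, x, rfl⟩
  · simp
  refine Or.inr (Or.inr ⟨P, x, rfl, fun hx => ?_⟩)
  have hy : y * (x * b) ∈ J := by
    have := h₂ _ List.mem_cons_self
    rwa [leftAction_concat hM h (fun z hz => hCI z (List.mem_append_left _ hz))
      (hL.of_subset (List.subset_append_left _ _)) h₁] at this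
  obtain ⟨P₁, P₂, rfl⟩ := List.append_of_mem hx
  obtain ⟨z, R, hzR⟩ : ∃ z R, P₂ ++ [x] = z :: R := by
    cases P₂ with
    | nil => exact ⟨x, [], rfl⟩
    | cons z R => exact ⟨z, R ++ [x], rfl⟩
  have hsplit : P₁ ++ x :: P₂ ++ [x] = (P₁ ++ [x]) ++ z :: R := by
    rw [← hzR]; simp
  rw [hsplit] at hCI hL h₁
  rw [stateAfter_append] at h₁
  have hzb : z * (x * b) ∉ J := by
    have hx' := leftAction_concat hM h (P := P₁) (x := x) (b := b)
      (fun w hw => hCI w (List.mem_append_left _ (List.mem_append_left _ hw)))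
      (hL.of_subset fun w hw => List.mem_append_left _ (List.mem_append_left _ hw))
      (fun t ht => h₁ t (List.mem_append_left _ ht))
    rw [← hx']
    exact (h₁ _ (List.mem_append_right _ List.mem_cons_self)).2
  obtain ⟨u, rfl⟩ := hL z (by simp) y (by simp)
  exact hzb (by rw [mul_assoc]; exact h.mul_left_lower hy u)

end PrincipalFactor

/-! ### Finiteness for words over one 𝓛-class -/

open Classical in
/-- The prefixes of `B` that occur in the states reachable from `B`: the empty word, `B` itself, and
the prefixes ending at the first occurrence of a letter (again `B` if the letter does not occur). -/
noncomputable def firstOccurrencePrefix {A : Type*} (B : List A) : Option (Option A) → List A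
  | none => []
  | some none => B
  | some (some x) => B.take (B.idxOf x + 1)

theorem firstOccurrencePrefix_isPrefix {A : Type*} (B : List A) (p : Option (Option A)) :
    firstOccurrencePrefix B p <+: B := by
  rcases p with _ | _ | x
  · exact List.nil_prefix
  · exact List.prefix_rfl
  · exact List.take_prefix _ _

open Classical in
theorem exists_firstOccurrencePrefix_eq {A : Type*} {B P : List A} {x : A} (hP : P ++ [x] <+: B)
    (hx : x ∉ P) : ∃ p, firstOccurrencePrefix B p = P ++ [x] := by
  obtain ⟨R, rfl⟩ := hP
  refine ⟨some (some x), ?_⟩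
  rw [firstOccurrencePrefix, List.append_assoc, List.idxOf_append_of_notMem hx]
  simp [List.take_append]

theorem finite_wordMap_greenL [Finite M] (hM : ∀ x : M, ∃ n : ℕ, x ^ (n + 1) = x ^ n)
    {I J : Set M} (h : IsPrincipalFactor J I) (hJ : (wordMap '' {σ | ∀ s ∈ σ, s ∈ J}).Finite) :
    (wordMap '' {B | (∀ s ∈ B, s ∈ I) ∧ IsGreenLWord B}).Finite := by
  refine finite_of_uniform_recursion (ι := Option (Option M) × M) hJ ?_
  rintro _ ⟨B, ⟨hBI, hL⟩, rfl⟩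
  let C (i : Option (Option M) × M) : List M := (firstOccurrencePrefix B i.1).map (· * i.2)
  refine ⟨fun i => wordMap (C i), ⟨(some none, 1), by simp [C, firstOccurrencePrefix]⟩,
    fun i => wordMap_nil_right _, fun i => leftAction (C i), fun ⟨p, c⟩ b => ?_⟩
  have hpre := firstOccurrencePrefix_isPrefix B p
  obtain ⟨C₁, C₂, τ, hC, hstate, hτ, hcases⟩ := exists_stateAfter_eq_map_append hM h (C := C (p, c))
    (by
      simp only [C, List.mem_map]
      rintro _ ⟨x, hx, rfl⟩
      exact h.mul_right_upper (hBI x (hpre.subset hx)) c)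
    ((hL.of_subset hpre.subset).map_mul_right c) b
  suffices ∃ q, C₁ = C (q, c) by
    obtain ⟨q, hq⟩ := this
    refine ⟨wordMap τ, ⟨τ, hτ, rfl⟩, (q, c * b), fun w => ?_⟩
    have hC₁ : C₁.map (· * b) = C (q, c * b) := by
      rw [hq]; simp [C]
    simp only [wordMap_cons_right, hstate, wordMap_append, hC₁, Function.comp]
  rcases hcases with rfl | rfl | ⟨P, x, rfl, hx⟩
  · exact ⟨none, rfl⟩
  · exact ⟨p, by rw [hC, List.append_nil]⟩
  · obtain ⟨D₁, D₂, hD, hD₁, -⟩ := List.map_eq_append_iff.1 hC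
    obtain ⟨P', X, rfl, rfl, hX⟩ := List.map_eq_append_iff.1 hD₁
    obtain ⟨x, rfl, rfl⟩ : ∃ x', X = [x'] ∧ x' * c = x := by
      rcases X with _ | ⟨x', _ | _⟩ <;> simp_all
    obtain ⟨q, hq⟩ := exists_firstOccurrencePrefix_eq (B := B) (P := P') (x := x)
      ((hD ▸ List.prefix_append _ _ : P' ++ [x] <+: firstOccurrencePrefix B p).trans hpre)
      fun hx' => hx (List.mem_map_of_mem hx')
    exact ⟨q, by simp [C, hq]⟩

/-! ### Induction on ideals -/

theorem finite_wordMap_of_isPrincipalFactor [Finite M]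
    (hM : ∀ x : M, ∃ n : ℕ, x ^ (n + 1) = x ^ n) {I J : Set M} (h : IsPrincipalFactor J I)
    (hJ : (wordMap '' {σ | ∀ s ∈ σ, s ∈ J}).Finite) :
    (wordMap '' {σ | ∀ s ∈ σ, s ∈ I}).Finite := by
  have hH := Set.Finite.image2 (fun g f : List M → List M => g ∘ f) hJ
    (finite_wordMap_greenL hM h hJ)
  refine finite_of_uniform_recursion (ι := Bool) hH ?_
  rintro _ ⟨σ, hσ, rfl⟩
  -- the index `false` stands for the identity map, so that no further recursion takes place
  refine ⟨fun i => bif i then wordMap σ else id, ⟨true, rfl⟩, ?_,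
    fun i => bif i then leftAction σ else id, ?_⟩
  · rintro (_ | _)
    · rfl
    · exact wordMap_nil_right σ
  rintro (_ | _) b
  · exact ⟨id, ⟨id, ⟨[], by simp, rfl⟩, id, ⟨[], by simp [IsGreenLWord], rfl⟩, rfl⟩, false,
      fun w => rfl⟩
  · obtain ⟨C₁, C₂, rfl, h₁, h₂⟩ := exists_stateAfter_split h σ hσ b
    refine ⟨_, ⟨_, ⟨_, h₂, rfl⟩, _, ⟨_, ⟨fun t ht => (h₁ t ht).1,
      isGreenLWord_stateAfter hM h C₁ h₁⟩, rfl⟩, rfl⟩, false, fun w => ?_⟩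
    simp only [cond_true, cond_false]
    rw [wordMap_cons_right, stateAfter_append, wordMap_append]
    rfl

theorem finite_wordMap_of_ideal [Finite M] (hM : ∀ x : M, ∃ n : ℕ, x ^ (n + 1) = x ^ n)
    (I : Set M) (hI : ∀ x ∈ I, ∀ a b : M, a * x * b ∈ I) :
    (wordMap '' {σ | ∀ s ∈ σ, s ∈ I}).Finite := by
  induction I using WellFoundedLT.induction with
  | ind I ih =>
    rcases I.eq_empty_or_nonempty with rfl | hne
    · refine (Set.finite_singleton (wordMap [])).subset ?_
      rintro _ ⟨σ, hσ, rfl⟩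
      rw [List.eq_nil_iff_forall_not_mem.2 hσ]
      rfl
    · obtain ⟨J, hJI, hJ⟩ := exists_isPrincipalFactor hI hne
      exact finite_wordMap_of_isPrincipalFactor hM hJ (ih J hJI hJ.lower)

theorem finite_range_wordMap [Finite M] (hM : ∀ x : M, ∃ n : ℕ, x ^ (n + 1) = x ^ n) :
    (Set.range (wordMap (M := M))).Finite := by
  simpa using finite_wordMap_of_ideal hM Set.univ (by simp)

end WordMap

/-! ### Semigroups -/

section Semigroup

variable {S : Type*} [Semigroup S]

/-- The high powers of `s` form a subgroup of `S`; in an aperiodic semigroup it is trivial, so the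
powers of `s` become constant. -/
theorem IsAperiodic.exists_pow_succ_eq_pow [Finite S] (hS : IsAperiodic S) (x : WithOne S) :
    ∃ n : ℕ, x ^ (n + 1) = x ^ n := by
  cases x with
  | one => exact ⟨0, by simp⟩
  | coe s =>
    have : Finite (WithOne S) := inferInstanceAs (Finite (Option S))
    obtain ⟨i, j, hij, hpow⟩ : ∃ i j : ℕ, i < j ∧ (s : WithOne S) ^ i = (s : WithOne S) ^ j := by
      obtain ⟨i, j, hne, h⟩ := Finite.exists_ne_map_eq_of_infinite fun n : ℕ => (s : WithOne S) ^ n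
      rcases hne.lt_or_gt with hlt | hlt
      · exact ⟨i, j, hlt, h⟩
      · exact ⟨j, i, hlt, h.symm⟩
    obtain ⟨d, rfl⟩ := Nat.exists_eq_add_of_lt hij
    have hper : ∀ m k : ℕ, i ≤ m →
        (s : WithOne S) ^ (m + k * (d + 1)) = (s : WithOne S) ^ m := by
      intro m k hm
      obtain ⟨m, rfl⟩ := Nat.exists_eq_add_of_le hm
      induction k with
      | zero => simp
      | succ k ih =>
        calc (s : WithOne S) ^ (i + m + (k + 1) * (d + 1))
            = (s : WithOne S) ^ (i + d + 1) * (s : WithOne S) ^ (m + k * (d + 1)) := by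
              rw [← pow_add]; congr 1; ring
          _ = (s : WithOne S) ^ (i + m + k * (d + 1)) := by
              rw [← hpow, ← pow_add]; congr 1; ring
          _ = _ := ih
    have hcoe : ∀ m : ℕ, ∃ t : S, (t : WithOne S) = (s : WithOne S) ^ (m + 1) := by
      intro m
      induction m with
      | zero => exact ⟨s, by simp⟩
      | succ m ih =>
        obtain ⟨t, ht⟩ := ih
        exact ⟨t * s, by rw [WithOne.coe_mul, ht, ← pow_succ]⟩
    let G : Subsemigroup S :=
      { carrier := {t | ∃ m : ℕ, (t : WithOne S) = (s : WithOne S) ^ (i + m + 1)}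
        mul_mem' := by
          rintro a b ⟨m, hm⟩ ⟨k, hk⟩
          exact ⟨m + i + k + 1, by rw [WithOne.coe_mul, hm, hk, ← pow_add]; congr 1; ring⟩ }
    have hG : IsSubgroupOfSemigroup G := by
      obtain ⟨e, he⟩ := hcoe (i + (i + 1) * d)
      have he' : (e : WithOne S) = (s : WithOne S) ^ ((i + 1) * (d + 1)) := by
        rw [he]; congr 1; ring
      refine ⟨e, ⟨(i + 1) * d, he⟩, ?_, ?_⟩
      · rintro x ⟨m, hm⟩
        constructor <;> apply WithOne.coe_injective <;>
          rw [WithOne.coe_mul, hm, he', ← pow_add]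
        · rw [add_comm]; exact hper _ _ (by omega)
        · exact hper _ _ (by omega)
      · rintro x ⟨m, hm⟩
        -- the exponents of `x` and its inverse add up to a large multiple of the period
        obtain ⟨y, hy⟩ := hcoe (i + ((i + m + 1) * d + (i + 1) * d))
        have hxy : (s : WithOne S) ^ (i + m + 1 + (i + ((i + m + 1) * d + (i + 1) * d) + 1)) = e := by
          have hle : i ≤ (i + 1) * (d + 1) :=
            (Nat.le_succ i).trans (Nat.le_mul_of_pos_right _ d.succ_pos)
          rw [he', ← hper _ (i + m + 1) hle]
          congr 1; ring
        refine ⟨y, ⟨_, hy⟩, ?_, ?_⟩ <;> apply WithOne.coe_injective <;>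
          rw [WithOne.coe_mul, hm, hy, ← pow_add]
        · exact hxy
        · rw [add_comm]; exact hxy
    obtain ⟨a, ha⟩ := hcoe i
    obtain ⟨b, hb⟩ := hcoe (i + 1)
    have hab : a = b := hS G hG ⟨0, by simpa using ha⟩ ⟨1, by simpa using hb⟩
    exact ⟨i + 1, by rw [← ha, ← hb, hab]⟩

theorem map_val_partialProducts (T : Subsemigroup (WithOne S)) (q : T) (w : List T) :
    (partialProducts q w).map Subtype.val = partialProducts (q : WithOne S) (w.map Subtype.val) := by
  induction w generalizing q with
  | nil => rfl
  | cons a w ih => simp [partialProducts, ih]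

theorem exists_wordMap_of_mem_cayley {h : Function.End (List (adjoinIdentity S))}
    (hh : h ∈ Cayley S) :
    ∃ σ : List (WithOne S), ∀ w, (h w).map Subtype.val = wordMap σ (w.map Subtype.val) := by
  induction hh using Subsemigroup.closure_induction with
  | mem h hh =>
    obtain ⟨s, rfl⟩ := hh
    exact ⟨[(s : WithOne S)], fun w => map_val_partialProducts _ _ w⟩
  | mul f g _ _ hf hg =>
    obtain ⟨σ, hσ⟩ := hf
    obtain ⟨τ, hτ⟩ := hg
    refine ⟨τ ++ σ, fun w => ?_⟩
    rw [wordMap_append, Function.comp, ← hτ, ← hσ]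
    rfl

end Semigroup

theorem mainTheorem1 (S : Type*) [Semigroup S] [Finite S] (hS : IsAperiodic S) :
    Finite (Cayley S) := by
  have : Finite (WithOne S) := inferInstanceAs (Finite (Option S))
  have := (finite_range_wordMap hS.exists_pow_succ_eq_pow).to_subtype
  choose σ hσ using fun h : Cayley S => exists_wordMap_of_mem_cayley h.2
  refine Finite.of_injective
    (fun h : Cayley S => (⟨wordMap (σ h), σ h, rfl⟩ : Set.range (wordMap (M := WithOne S)))) ?_
  intro f g hfg
  refine Subtype.ext (funext fun w => List.map_injective_iff.2 Subtype.val_injective ?_)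
  rw [hσ, hσ, Subtype.mk.inj hfg]
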